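/- Let $Z=\{x_1,\dots,x_n\}$ be a finite set of options and $m=\binom n2$. A choice vector $\rho\in\mathbb R^m$ has entries $\rho(x_i,x_j)$, $i<j$, and is extended to all ordered pairs by $\rho(x,y)+\rho(y,x)=1$. **Models.** $\rho$ satisfies *Simple Scalability* (SS) if $\rho(x,y)=F(u(x),u(y))$ for all $x,y\in Z$, for some $u:Z\to\mathbb R$ and some $F:\mathbb R\times\mathbb R\to(0,1)$ strictly increasing in the first and strictly decreasing in the second argument with $F(a,b)=1-F(b,a)$. It satisfies *Weak Utility* (WU) if $\rho(x,y)=F\big(\tfrac{u(x)-u(y)}{c(x,y)}\big)$ for all $x\ne y$, for some $u:Z\to\mathbb R$, some strictly increasing $F:\mathbb R\to[0,1]$ with $F(t)=1-F(-t)$, and some semimetric $c$ on $Z$ (nonnegative, symmetric, zero exactly on the diagonal); it satisfies *Moderate Utility* (MU) if moreover $c$ can be chosen to satisfy the triangle inequality. For $M\in\{\mathrm{SS},\mathrm{MU},\mathrm{WU}\}$ let $S_M$ be the set of choice vectors satisfying $M$. For a set $S$ of choice vectors let $\mathrm{Coll}(S)$ be the set of all $\sum_{i=1}^N\lambda_i\rho_i$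 with $N\ge1$, $\lambda_i>0$, $\sum_i\lambda_i=1$ and $\rho_i\in S$; the elements of $\mathrm{Coll}(S_M)$ are the vectors collectively rationalizable by $M$. **Polytopes.** A permutation $\pi$ of $\{1,\dots,n\}$ stands for the preference $x_{\pi(1)}\succ\dots\succ x_{\pi(n)}$; let $\rho^*_\pi\in\{0,1\}^m$ be its deterministic choice rule, $\rho^*_\pi(x_i,x_j)=1$ iff $x_i\succ x_j$. Each model has a finite family of systems of linear inequalities $A_k\rho\le b_k$ in $\rho\in\mathbb R^m$ (after substituting $\rho(y,x)=1-\rho(x,y)$ where needed): - WU, one system per $\pi$: $|\rho(x_i,x_j)-\rho^*_\pi(x_i,x_j)|\le\tfrac12$ for all $i<j$. - SS, one system per $\pi$: the WU inequalities for $\pi$, and, for all $u<v<w$, $\rho(x_{\pi(u)},x_{\pi(v)})\le\rho(x_{\pi(u)},x_{\pi(w)})$ and $\rho(x_{\pi(v)},x_{\pi(w)})\le\rho(x_{\pi(u)},x_{\pi(w)})$. - MU, one system per pair $(\pi,\tau)$, where $\tau$ is an ordering of the $m$ index pairs $(i,j)$, $i<j$, such that for all $i<j<k$ the pair $(i,k)$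 does not come before both $(i,j)$ and $(j,k)$: the WU inequalities for $\pi$, and $\rho(x_{\pi(i)},x_{\pi(j)})\le\rho(x_{\pi(i')},x_{\pi(j')})$ whenever $(i',j')$ comes immediately after $(i,j)$ in $\tau$. Let $P_M$ be the set of all vertices (extreme points) of all the polytopes $\{\rho\in[0,1]^m: A_k\rho\le b_k\}$ of the model $M$. **Theorem.** For each $M\in\{\mathrm{SS},\mathrm{MU},\mathrm{WU}\}$ the set $P_M$ is finite, and for every $\rho\in[0,1]^m$ the following are equivalent. (i) $\rho$ is collectively rationalizable by $M$, up to closure: $\rho\in\overline{\mathrm{Coll}(S_M)}$. (i′) $\rho$ is a finite convex combination of vectors in the closure of the individually rationalizable set: $\rho\in\mathrm{Coll}(\overline{S_M})$. (ii) $\rho\in\mathrm{conv}(P_M)$. (iii) There are vectors $\rho_k\in\mathbb R^m$ and numbers $x_k\ge0$ with $\sum_k x_k=1$, $k$ ranging over the systems of $M$ ($n!$ of them for SS and WU), such that $\rho=\sum_k\rho_k$ and, for every $k$, $0\le\rho_k\le x_k\mathbf 1$ and $A_k\rho_k\le x_kb_k$. -/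

import Mathlib

open scoped Matrix

namespace StochasticChoice

noncomputable section

/-- The pairs `(i, j)` with `i < j` of the options `x_1, …, x_n`; there are `m = n(n-1)/2`. -/
abbrev Pair (n : ℕ) : Type := {p : Fin n × Fin n // p.1 < p.2}

/-- A choice vector: its entry at the pair `(i, j)`, `i < j`, is `ρ(x_i, x_j)`. -/
abbrev ChoiceVec (n : ℕ) : Type := Pair n → ℝ

/-- The binary choice rule given by a choice vector, on all ordered pairs of options:
`ρ(x, y) + ρ(y, x) = 1` for all `x, y` (so the diagonal value is `1/2`). -/
def rule {n : ℕ} (ρ : ChoiceVec n) (x y : Fin n) : ℝ :=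
  if h : x < y then ρ ⟨(x, y), h⟩
  else if h : y < x then 1 - ρ ⟨(y, x), h⟩
  else 1 / 2

/-! ### The three models of an individual -/

/-- Simple Scalability: `ρ(x, y) = F(u(x), u(y))`. -/
def IsSS {n : ℕ} (ρ : ChoiceVec n) : Prop :=
  ∃ (u : Fin n → ℝ) (F : ℝ → ℝ → ℝ),
    (∀ a b, F a b ∈ Set.Ioo (0 : ℝ) 1) ∧
    (∀ b, StrictMono fun a => F a b) ∧
    (∀ a, StrictAnti fun b => F a b) ∧
    (∀ a b, F a b = 1 - F b a) ∧
    ∀ x y, rule ρ x y = F (u x) (u y)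

/-- A semimetric on the options. -/
structure IsSemimetric {n : ℕ} (c : Fin n → Fin n → ℝ) : Prop where
  nonneg : ∀ x y, 0 ≤ c x y
  eq_zero_iff : ∀ x y, c x y = 0 ↔ x = y
  symm : ∀ x y, c x y = c y x

/-- `ρ(x, y) = F((u(x) - u(y)) / c(x, y))` on all binary menus, where `F : ℝ → [0, 1]` is
strictly increasing with `F(t) = 1 - F(-t)`. -/
def HasDifficultyForm {n : ℕ} (c : Fin n → Fin n → ℝ) (ρ : ChoiceVec n) : Prop :=
  ∃ (u : Fin n → ℝ) (F : ℝ → ℝ),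
    (∀ t, F t ∈ Set.Icc (0 : ℝ) 1) ∧
    StrictMono F ∧
    (∀ t, F t = 1 - F (-t)) ∧
    ∀ x y, x ≠ y → rule ρ x y = F ((u x - u y) / c x y)

/-- Moderate Utility: the comparison difficulty `c` is a metric. -/
def IsMU {n : ℕ} (ρ : ChoiceVec n) : Prop :=
  ∃ c : Fin n → Fin n → ℝ, IsSemimetric c ∧ (∀ x y z, c x z ≤ c x y + c y z) ∧
    HasDifficultyForm c ρ

/-- Weak Utility: the comparison difficulty `c` is a semimetric. -/
def IsWU {n : ℕ} (ρ : ChoiceVec n) : Prop :=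
  ∃ c : Fin n → Fin n → ℝ, IsSemimetric c ∧ HasDifficultyForm c ρ

/-! ### Collective rationalizability -/

/-- The choice vectors `∑ λ_i ρ_i` for a positive number of individuals, positive weights `λ_i`
with sum `1`, and choice vectors `ρ_i` in `R`. -/
def collective {n : ℕ} (R : Set (ChoiceVec n)) : Set (ChoiceVec n) :=
  {ρ | ∃ (N : ℕ) (w : Fin N → ℝ) (r : Fin N → ChoiceVec n),
    0 < N ∧ (∀ i, 0 < w i) ∧ ∑ i, w i = 1 ∧ (∀ i, r i ∈ R) ∧ ρ = ∑ i, w i • r i}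

/-! ### Finite families of polytopes `{ρ ∈ [0, 1]^m | A_k ρ ≤ b_k}` -/

/-- The polytope of all `ρ ∈ [0, 1]^m` with `A ρ ≤ b`. -/
def polytope {n : ℕ} {κ : Type} (A : Matrix κ (Pair n) ℝ) (b : κ → ℝ) : Set (ChoiceVec n) :=
  {ρ | 0 ≤ ρ ∧ ρ ≤ 1 ∧ A *ᵥ ρ ≤ b}

/-- All vertices of all polytopes of the family. -/
def vertices {n : ℕ} {ι κ : Type} (A : ι → Matrix κ (Pair n) ℝ) (b : ι → κ → ℝ) :
    Set (ChoiceVec n) :=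
  ⋃ k, Set.extremePoints ℝ (polytope (A k) (b k))

/-- Feasibility of the lifted linear system in the unknowns `(ρ_k)_k` and `x`:
`ρ = ∑ ρ_k`, `x` in the simplex, `0 ≤ ρ_k ≤ x_k 1`, `A_k ρ_k ≤ x_k b_k`. -/
def LiftedFeasible {n : ℕ} {ι κ : Type} [Fintype ι] (A : ι → Matrix κ (Pair n) ℝ)
    (b : ι → κ → ℝ) (ρ : ChoiceVec n) : Prop :=
  ∃ (r : ι → ChoiceVec n) (x : ι → ℝ),
    ρ = ∑ k, r k ∧ x ∈ stdSimplex ℝ ι ∧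
    ∀ k, 0 ≤ r k ∧ r k ≤ x k • (1 : ChoiceVec n) ∧ A k *ᵥ r k ≤ x k • b k

/-! ### The inequality systems of the three models

A permutation `π` stands for the strict preference `x_{π(1)} ≻ x_{π(2)} ≻ … ≻ x_{π(n)}`. -/

/-- The rational deterministic choice rule of a permutation `σ`: `x_i` is chosen over `x_j` if and
only if `σ(i) < σ(j)`. -/
def detRule {n : ℕ} (σ : Equiv.Perm (Fin n)) : ChoiceVec n :=
  fun p => if σ p.1.1 < σ p.1.2 then 1 else 0

/-- Coefficients of the affine function `ρ ↦ ρ(x, y)`, for `x ≠ y`. -/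
def pairCoeff {n : ℕ} (x y : Fin n) : Pair n → ℝ :=
  fun p => if p.1 = (x, y) then 1 else if p.1 = (y, x) then -1 else 0

/-- Constant term of the affine function `ρ ↦ ρ(x, y)`, for `x ≠ y`. -/
def pairConst {n : ℕ} (x y : Fin n) : ℝ := if y < x then 1 else 0

/-- `-ρ ≤ 1/2 - ρ*` and `ρ ≤ 1/2 + ρ*`, that is, `|ρ - ρ*| ≤ 1/2` in every entry, where `ρ*` is the
deterministic choice rule of the preference `π`. -/
def matWU {n : ℕ} (_π : Equiv.Perm (Fin n)) : Matrix (Pair n ⊕ Pair n) (Pair n) ℝ :=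
  Matrix.fromRows (-1) 1

/-- The right-hand side that belongs to `matWU`. -/
def rhsWU {n : ℕ} (π : Equiv.Perm (Fin n)) : Pair n ⊕ Pair n → ℝ :=
  Sum.elim (fun p => 1 / 2 - detRule π.symm p) (fun p => 1 / 2 + detRule π.symm p)

/-- Triples of positions `u < v < w`. -/
abbrev Triple (n : ℕ) : Type := {t : Fin n × Fin n × Fin n // t.1 < t.2.1 ∧ t.2.1 < t.2.2}

/-- The inequalities of the hypercube, and, for all `u < v < w`,
`ρ(x_{π(u)}, x_{π(v)}) ≤ ρ(x_{π(u)}, x_{π(w)})` and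
`ρ(x_{π(v)}, x_{π(w)}) ≤ ρ(x_{π(u)}, x_{π(w)})`. -/
def matSS {n : ℕ} (π : Equiv.Perm (Fin n)) :
    Matrix ((Pair n ⊕ Pair n) ⊕ (Triple n ⊕ Triple n)) (Pair n) ℝ :=
  Matrix.fromRows (matWU π) (Matrix.fromRows
    (Matrix.of fun t : Triple n =>
      pairCoeff (π t.1.1) (π t.1.2.1) - pairCoeff (π t.1.1) (π t.1.2.2))
    (Matrix.of fun t : Triple n =>
      pairCoeff (π t.1.2.1) (π t.1.2.2) - pairCoeff (π t.1.1) (π t.1.2.2)))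

/-- The right-hand side that belongs to `matSS`. -/
def rhsSS {n : ℕ} (π : Equiv.Perm (Fin n)) :
    (Pair n ⊕ Pair n) ⊕ (Triple n ⊕ Triple n) → ℝ :=
  Sum.elim (rhsWU π) (Sum.elim
    (fun t => pairConst (π t.1.1) (π t.1.2.2) - pairConst (π t.1.1) (π t.1.2.1))
    (fun t => pairConst (π t.1.1) (π t.1.2.2) - pairConst (π t.1.2.1) (π t.1.2.2)))

/-- The number `m` of pairs. -/
abbrev numPairs (n : ℕ) : ℕ := Fintype.card (Pair n)

/-- The orderings `τ(1), …, τ(m)` of all pairs `(i, j)`, `i < j`, by increasing choice probability,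
that are compatible with moderate stochastic transitivity under the preference
`x_1 ≻ … ≻ x_n`: for `i < j < k`, the pair `(i, k)` does not come before both `(i, j)` and
`(j, k)`. -/
abbrev ModerateOrder (n : ℕ) : Type :=
  {τ : Fin (numPairs n) ≃ Pair n // ∀ (i j k : Fin n) (hij : i < j) (hjk : j < k),
    min (τ.symm ⟨(i, j), hij⟩) (τ.symm ⟨(j, k), hjk⟩) ≤ τ.symm ⟨(i, k), hij.trans hjk⟩}

/-- The pair at position `s` of the ordering. -/
def ModerateOrder.lower {n : ℕ} (τ : ModerateOrder n) (s : Fin (numPairs n - 1)) :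
    Fin n × Fin n :=
  (τ.1 ⟨s.1, by omega⟩).1

/-- The pair at position `s + 1` of the ordering. -/
def ModerateOrder.upper {n : ℕ} (τ : ModerateOrder n) (s : Fin (numPairs n - 1)) :
    Fin n × Fin n :=
  (τ.1 ⟨s.1 + 1, by omega⟩).1

/-- The inequalities of the hypercube, and, for consecutive pairs `(i, j)`, `(i', j')` of the
ordering `τ`, `ρ(x_{π(i)}, x_{π(j)}) ≤ ρ(x_{π(i')}, x_{π(j')})`. -/
def matMU {n : ℕ} (k : Equiv.Perm (Fin n) × ModerateOrder n) :
    Matrix ((Pair n ⊕ Pair n) ⊕ Fin (numPairs n - 1)) (Pair n) ℝ :=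
  Matrix.fromRows (matWU k.1) (Matrix.of fun s =>
    pairCoeff (k.1 (k.2.lower s).1) (k.1 (k.2.lower s).2) -
      pairCoeff (k.1 (k.2.upper s).1) (k.1 (k.2.upper s).2))

/-- The right-hand side that belongs to `matMU`. -/
def rhsMU {n : ℕ} (k : Equiv.Perm (Fin n) × ModerateOrder n) :
    (Pair n ⊕ Pair n) ⊕ Fin (numPairs n - 1) → ℝ :=
  Sum.elim (rhsWU k.1) (fun s =>
    pairConst (k.1 (k.2.upper s).1) (k.1 (k.2.upper s).2) -
      pairConst (k.1 (k.2.lower s).1) (k.1 (k.2.lower s).2))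

/-- The vertex set for Simple Scalability. -/
def verticesSS (n : ℕ) : Set (ChoiceVec n) := vertices (matSS (n := n)) rhsSS

/-- The vertex set for Moderate Utility. -/
def verticesMU (n : ℕ) : Set (ChoiceVec n) := vertices (matMU (n := n)) rhsMU

/-- The vertex set for Weak Utility. -/
def verticesWU (n : ℕ) : Set (ChoiceVec n) := vertices (matWU (n := n)) rhsWU

end

end StochasticChoice

open StochasticChoice

namespace StochasticChoice

/-! ### Convex hulls of finite unions of polytopes -/

/-! For each model the closure of the individually rationalizable set is exactly the finite union of
the model's polytopes (`closure_isSS`, `closure_isMU`, `closure_isWU`). Everything else is convex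
geometry, collected in `tfae_of_closure_eq`: collective choice is the convex hull; the hull of a
finite union of polytopes is the hull of their finitely many vertices, hence closed, so hull and
closure commute; and the lifted system is the disjunctive-programming description of such a hull.

That a model lies in its polytopes follows by sorting the options by utility. For Moderate Utility
the pairs are also sorted by choice probability; the triangle inequality enters through the mediant
inequality `min_div_le_add_div_of_le_add`.

Conversely, for a vector of a polytope one chooses utilities (ranks) and, where needed, a difficulty
`c`, so that the vector is weakly monotone in the arguments of `F`. `exists_monotone_skew_extension`
yields a weakly monotone `F`, and mixing in a small multiple of a sigmoid-based function makes it
strictly monotone. For Weak Utility `c` can realize any prescribed ratios of the right sign; for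
Moderate Utility it is a slightly distorted line metric, `ModerateOrder.dist`, whose ratios are
ordered as `τ` demands. -/

theorem collective_eq_convexHull {n : ℕ} (R : Set (ChoiceVec n)) :
    collective R = convexHull ℝ R := by
  ext ρ
  constructor
  · rintro ⟨N, w, r, -, hw, hs, hr, rfl⟩
    exact (convex_convexHull ℝ R).sum_mem (fun i _ => (hw i).le) hs
      fun i _ => subset_convexHull ℝ R (hr i)
  · intro h
    obtain ⟨ι, _, z, w, hz, -, hw, hs, rfl⟩ := eq_pos_convex_span_of_mem_convexHull h
    let e := Fintype.equivFin ι
    refine ⟨Fintype.card ι, w ∘ e.symm, z ∘ e.symm, ?_, fun i => hw _, ?_,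
      fun i => hz ⟨_, rfl⟩, ?_⟩
    · rw [Fintype.card_pos_iff]
      by_contra hne
      rw [not_nonempty_iff] at hne
      simp at hs
    · rw [← hs]
      exact e.symm.sum_comp w
    · exact (e.symm.sum_comp fun i => w i • z i).symm

section Polytope

variable {n : ℕ} {κ : Type} (A : Matrix κ (Pair n) ℝ) (b : κ → ℝ)

theorem mem_polytope_iff {ρ : ChoiceVec n} :
    ρ ∈ polytope A b ↔ (∀ p, 0 ≤ ρ p) ∧ (∀ p, ρ p ≤ 1) ∧ ∀ i, (A *ᵥ ρ) i ≤ b i := Iff.rfl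

theorem convex_polytope : Convex ℝ (polytope A b) := by
  rintro x ⟨hx0, hx1, hx⟩ y ⟨hy0, hy1, hy⟩ s t hs ht hst
  refine ⟨by positivity, ?_, ?_⟩
  · exact (convex_Iic (1 : ChoiceVec n)) hx1 hy1 hs ht hst
  · rw [Matrix.mulVec_add, Matrix.mulVec_smul, Matrix.mulVec_smul]
    exact (convex_Iic b) hx hy hs ht hst

theorem isCompact_polytope : IsCompact (polytope A b) := by
  have h : polytope A b = Set.Icc 0 1 ∩ {ρ | A *ᵥ ρ ≤ b} := by
    ext ρ
    exact ⟨fun h => ⟨⟨h.1, h.2.1⟩, h.2.2⟩, fun h => ⟨h.1.1, h.1.2, h.2⟩⟩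
  rw [h]
  refine isCompact_Icc.inter_right (isClosed_le ?_ continuous_const)
  exact continuous_const.matrix_mulVec continuous_id

/-- Near `x`, the line through `x` and `y` satisfies an upper bound of `x` that `y` attains if `x`
does. -/
theorem eventually_lineMap_le {x y c : ℝ} (hx : x ≤ c) (h : x = c → y = c) :
    ∀ᶠ t : ℝ in nhds 0, x + t * (y - x) ≤ c := by
  rcases hx.eq_or_lt with hx | hx
  · have := h hx
    filter_upwards with t
    rw [this, hx]
    simp
  · have hc : Filter.Tendsto (fun t : ℝ => x + t * (y - x)) (nhds 0) (nhds x) := by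
      have : Continuous fun t : ℝ => x + t * (y - x) := by fun_prop
      simpa using this.tendsto 0
    exact (hc.eventually (gt_mem_nhds hx)).mono fun t ht => ht.le

/-- An extreme point is determined by its set of active constraints, and there are finitely many
such sets. If every constraint active at `x` is active at `y`, a short segment around `x` in
direction `y - x` stays in the polytope on both sides, so extremality of `x` forces `y = x`. -/
theorem finite_extremePoints_polytope [Finite κ] :
    (Set.extremePoints ℝ (polytope A b)).Finite := by
  let act : ChoiceVec n → Set (Pair n) × Set (Pair n) × Set κ := fun ρ =>
    ({p | ρ p = 0}, {p | ρ p = 1}, {i | (A *ᵥ ρ) i = b i})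
  refine Set.Finite.of_finite_image (f := act) (Set.toFinite _) ?_
  rintro x hx y hy hxy
  obtain ⟨hx, hext⟩ := mem_extremePoints.1 hx
  obtain ⟨hx0, hx1, hxA⟩ := (mem_polytope_iff A b).1 hx
  have e0 : ∀ p, x p = 0 → y p = 0 := fun p hp =>
    (Set.ext_iff.1 (congrArg Prod.fst hxy) p).1 hp
  have e1 : ∀ p, x p = 1 → y p = 1 := fun p hp =>
    (Set.ext_iff.1 (congrArg (fun z => z.2.1) hxy) p).1 hp
  have eA : ∀ i, (A *ᵥ x) i = b i → (A *ᵥ y) i = b i := fun i hi =>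
    (Set.ext_iff.1 (congrArg (fun z => z.2.2) hxy) i).1 hi
  have hev : ∀ᶠ t : ℝ in nhds 0, x + t • (y - x) ∈ polytope A b := by
    simp only [mem_polytope_iff, Filter.eventually_and, Filter.eventually_all]
    refine ⟨fun p => ?_, fun p => ?_, fun i => ?_⟩
    · have := eventually_lineMap_le (x := -x p) (y := -y p) (c := 0) (by simpa using hx0 p)
        (by simpa using e0 p)
      filter_upwards [this] with t ht
      simp only [Pi.add_apply, Pi.smul_apply, Pi.sub_apply, smul_eq_mul]
      linarith
    · simpa using eventually_lineMap_le (hx1 p) (e1 p)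
    · simpa [Matrix.mulVec_add, Matrix.mulVec_smul, Matrix.mulVec_sub] using
        eventually_lineMap_le (hxA i) (eA i)
  have hneg : ∀ᶠ t : ℝ in nhds 0, x + (-t) • (y - x) ∈ polytope A b := by
    have : Filter.Tendsto (fun t : ℝ => -t) (nhds 0) (nhds 0) := by
      simpa using (continuous_neg (G := ℝ)).tendsto 0
    exact this.eventually hev
  obtain ⟨t, ⟨h1, h2⟩, ht⟩ :=
    (((hev.and hneg).filter_mono nhdsWithin_le_nhds).and
      (self_mem_nhdsWithin (s := Set.Ioi (0 : ℝ)))).exists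
  have hseg : x ∈ openSegment ℝ (x + t • (y - x)) (x + (-t) • (y - x)) := by
    refine ⟨1 / 2, 1 / 2, by norm_num, by norm_num, by norm_num, ?_⟩
    ext p
    simp only [Pi.add_apply, Pi.smul_apply, Pi.sub_apply, smul_eq_mul]
    ring
  have := (hext _ h1 _ h2 hseg).1
  have h0 : t • (y - x) = 0 := by simpa using this
  rcases smul_eq_zero.1 h0 with h | h
  · exact absurd h (ne_of_gt ht)
  · exact (sub_eq_zero.1 h).symm

end Polytope

section Family

variable {n : ℕ} {ι κ : Type} (A : ι → Matrix κ (Pair n) ℝ) (b : ι → κ → ℝ)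

/-- Krein–Milman for each polytope; the closure in it is superfluous because the hull of finitely
many points is closed. -/
theorem convexHull_vertices [Finite κ] :
    convexHull ℝ (vertices A b) = convexHull ℝ (⋃ k, polytope (A k) (b k)) := by
  apply (convexHull_mono (Set.iUnion_mono fun k => extremePoints_subset)).antisymm
  refine convexHull_min (Set.iUnion_subset fun k => ?_) (convex_convexHull ℝ _)
  rw [← closure_convexHull_extremePoints (isCompact_polytope (A k) (b k))
    (convex_polytope (A k) (b k)),
    ((finite_extremePoints_polytope (A k) (b k)).isClosed_convexHull ℝ).closure_eq]
  exact convexHull_mono (Set.subset_iUnion (fun k => Set.extremePoints ℝ (polytope (A k) (b k))) k)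

variable [Fintype ι]

theorem finite_vertices [Finite κ] : (vertices A b).Finite :=
  Set.finite_iUnion fun k => finite_extremePoints_polytope (A k) (b k)

theorem convex_liftedFeasible : Convex ℝ {ρ | LiftedFeasible A b ρ} := by
  rintro _ ⟨r, x, rfl, hx, h⟩ _ ⟨r', x', rfl, hx', h'⟩ s t hs ht hst
  refine ⟨s • r + t • r', s • x + t • x', ?_, convex_stdSimplex ℝ ι hx hx' hs ht hst,
    fun k => ⟨?_, ?_, ?_⟩⟩
  · simp [Finset.sum_add_distrib, Finset.smul_sum]
  · exact add_nonneg (smul_nonneg hs (h k).1) (smul_nonneg ht (h' k).1)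
  · have := add_le_add (smul_le_smul_of_nonneg_left (h k).2.1 hs)
      (smul_le_smul_of_nonneg_left (h' k).2.1 ht)
    simpa only [Pi.add_apply, Pi.smul_apply, smul_smul, add_smul, smul_eq_mul] using this
  · have := add_le_add (smul_le_smul_of_nonneg_left (h k).2.2 hs)
      (smul_le_smul_of_nonneg_left (h' k).2.2 ht)
    simpa only [Pi.add_apply, Pi.smul_apply, smul_smul, add_smul, smul_eq_mul,
      Matrix.mulVec_add, Matrix.mulVec_smul] using this

theorem liftedFeasible_of_mem_polytope {ρ : ChoiceVec n} {k : ι}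
    (h : ρ ∈ polytope (A k) (b k)) : LiftedFeasible A b ρ := by
  classical
  refine ⟨Pi.single k ρ, Pi.single k 1, by simp, single_mem_stdSimplex ℝ k, fun j => ?_⟩
  obtain rfl | hj := eq_or_ne j k
  · simpa [Pi.single_eq_same] using (show 0 ≤ ρ ∧ ρ ≤ 1 ∧ A j *ᵥ ρ ≤ b j from h)
  · simp [hj]

/-- The substitution `r k = x k • ρ_k` with `ρ_k` in the `k`-th polytope makes a convex combination
linear in the unknowns. -/
theorem liftedFeasible_iff (ρ : ChoiceVec n) :
    LiftedFeasible A b ρ ↔ ρ ∈ convexHull ℝ (⋃ k, polytope (A k) (b k)) := by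
  classical
  constructor
  · rintro ⟨r, x, rfl, hx, h⟩
    -- Boundedness matters here: the box constraints leave no recession directions, so a component
    -- of weight zero vanishes.
    have hz : ∀ k, x k = 0 → r k = 0 := fun k hk => by
      have := h k
      rw [hk, zero_smul] at this
      exact le_antisymm this.2.1 this.1
    have h1 : ∑ k, r k = ∑ k with x k ≠ 0, x k • ((x k)⁻¹ • r k) := by
      rw [Finset.sum_filter]
      refine Finset.sum_congr rfl fun k _ => ?_
      split_ifs with hk
      · rw [smul_inv_smul₀ hk]
      · exact hz k (not_not.1 hk)
    rw [h1]
    refine (convex_convexHull ℝ _).sum_mem (fun k _ => hx.1 k) ?_ fun k hk => ?_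
    · rw [← hx.2, Finset.sum_filter_ne_zero]
    · have hk : x k ≠ 0 := (Finset.mem_filter.1 hk).2
      have hp : 0 ≤ (x k)⁻¹ := inv_nonneg.2 (hx.1 k)
      refine subset_convexHull ℝ _ (Set.mem_iUnion.2 ⟨k, smul_nonneg hp (h k).1, ?_, ?_⟩)
      · simpa [inv_smul_smul₀ hk] using smul_le_smul_of_nonneg_left (h k).2.1 hp
      · simpa [Matrix.mulVec_smul, inv_smul_smul₀ hk] using
          smul_le_smul_of_nonneg_left (h k).2.2 hp
  · intro h
    refine convexHull_min (Set.iUnion_subset fun k ρ hρ => ?_) (convex_liftedFeasible A b) h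
    exact liftedFeasible_of_mem_polytope A b hρ

theorem closure_convexHull_eq_of_closure_eq [Finite κ] {S : Set (ChoiceVec n)}
    (h : closure S = ⋃ k, polytope (A k) (b k)) :
    closure (convexHull ℝ S) = convexHull ℝ (closure S) := by
  apply subset_antisymm
  · refine closure_minimal (convexHull_mono subset_closure) ?_
    rw [h, ← convexHull_vertices]
    exact (finite_vertices A b).isClosed_convexHull ℝ
  · exact convexHull_min (closure_mono (subset_convexHull ℝ S)) (convex_convexHull ℝ S).closure

theorem tfae_of_closure_eq [Finite κ] {S : Set (ChoiceVec n)}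
    (h : closure S = ⋃ k, polytope (A k) (b k)) (ρ : ChoiceVec n) :
    [ρ ∈ closure (collective S), ρ ∈ collective (closure S),
      ρ ∈ convexHull ℝ (vertices A b), LiftedFeasible A b ρ].TFAE := by
  rw [collective_eq_convexHull, collective_eq_convexHull,
    closure_convexHull_eq_of_closure_eq A b h, h, convexHull_vertices, liftedFeasible_iff]
  tfae_have 1 ↔ 2 := Iff.rfl
  tfae_have 2 ↔ 3 := Iff.rfl
  tfae_have 3 ↔ 4 := Iff.rfl
  tfae_finish

end Family

end StochasticChoice

namespace StochasticChoice

/-! ### Inequality systems in terms of choice rules -/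

section Rule

variable {n : ℕ}

theorem rule_of_lt (ρ : ChoiceVec n) {x y : Fin n} (h : x < y) : rule ρ x y = ρ ⟨(x, y), h⟩ :=
  dif_pos h

theorem rule_of_gt (ρ : ChoiceVec n) {x y : Fin n} (h : y < x) :
    rule ρ x y = 1 - ρ ⟨(y, x), h⟩ := by
  rw [rule, dif_neg h.asymm, dif_pos h]

theorem rule_self (ρ : ChoiceVec n) (x : Fin n) : rule ρ x x = 1 / 2 := by
  simp [rule]

theorem rule_swap (ρ : ChoiceVec n) (x y : Fin n) : rule ρ y x = 1 - rule ρ x y := by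
  rcases lt_trichotomy x y with h | rfl | h
  · rw [rule_of_lt ρ h, rule_of_gt ρ h]
  · rw [rule_self]; norm_num
  · rw [rule_of_lt ρ h, rule_of_gt ρ h]; ring

theorem rule_pair (ρ : ChoiceVec n) (p : Pair n) : rule ρ p.1.1 p.1.2 = ρ p :=
  rule_of_lt ρ p.2

theorem rule_mem_Icc {ρ : ChoiceVec n} (h0 : ∀ p, 0 ≤ ρ p) (h1 : ∀ p, ρ p ≤ 1) (x y : Fin n) :
    rule ρ x y ∈ Set.Icc (0 : ℝ) 1 := by
  rcases lt_trichotomy x y with h | rfl | h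
  · rw [rule_of_lt ρ h]; exact ⟨h0 _, h1 _⟩
  · rw [rule_self]; norm_num
  · rw [rule_of_gt ρ h]
    exact ⟨by linarith [h1 ⟨(y, x), h⟩], by linarith [h0 ⟨(y, x), h⟩]⟩

/-- `rule` is only affine in `ρ`; the weights sum to `1`, so its constant terms are preserved. -/
theorem rule_combo (ρ σ : ChoiceVec n) (t : ℝ) (x y : Fin n) :
    rule ((1 - t) • ρ + t • σ) x y = (1 - t) * rule ρ x y + t * rule σ x y := by
  rcases lt_trichotomy x y with h | rfl | h
  · simp [rule_of_lt _ h]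
  · simp only [rule_self]; ring
  · simp only [rule_of_gt _ h, Pi.add_apply, Pi.smul_apply, smul_eq_mul]; ring

theorem rule_eq_of_skew {ρ : ChoiceVec n} {f : Fin n → Fin n → ℝ}
    (hf : ∀ x y, x ≠ y → f y x = 1 - f x y) (h : ∀ p : Pair n, ρ p = f p.1.1 p.1.2) {x y : Fin n}
    (hxy : x ≠ y) : rule ρ x y = f x y := by
  rcases hxy.lt_or_gt with h' | h'
  · rw [rule_of_lt ρ h', h]
  · rw [rule_of_gt ρ h', h, hf x y hxy]; ring

theorem pairCoeff_dotProduct (ρ : ChoiceVec n) {x y : Fin n} (hxy : x ≠ y) :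
    pairCoeff x y ⬝ᵥ ρ = rule ρ x y - pairConst x y := by
  rcases hxy.lt_or_gt with h | h
  · have : pairCoeff x y = Pi.single (⟨(x, y), h⟩ : Pair n) (1 : ℝ) := by
      ext p
      have h2 : p.1 ≠ (y, x) := fun hp => by
        have := p.2
        rw [hp] at this
        exact h.asymm this
      simp [pairCoeff, Pi.single_apply, Subtype.ext_iff, h2]
    rw [this, single_one_dotProduct, rule_of_lt ρ h, pairConst, if_neg h.asymm, sub_zero]
  · have : pairCoeff x y = -Pi.single (⟨(y, x), h⟩ : Pair n) (1 : ℝ) := by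
      ext p
      have h2 : p.1 ≠ (x, y) := fun hp => by
        have := p.2
        rw [hp] at this
        exact h.asymm this
      simp [pairCoeff, Pi.single_apply, Subtype.ext_iff, h2, apply_ite]
    rw [this, neg_dotProduct, single_one_dotProduct, rule_of_gt ρ h, pairConst, if_pos h]
    ring

theorem pairCoeff_sub_le_iff (ρ : ChoiceVec n) {x y z w : Fin n} (hxy : x ≠ y) (hzw : z ≠ w) :
    (pairCoeff x y - pairCoeff z w) ⬝ᵥ ρ ≤ pairConst z w - pairConst x y ↔
      rule ρ x y ≤ rule ρ z w := by
  rw [sub_dotProduct, pairCoeff_dotProduct ρ hxy, pairCoeff_dotProduct ρ hzw]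
  constructor <;> intro h <;> linarith

/-- Inside the unit cube one of the two inequalities of each entry is automatic; the other says that
the preferred option has probability at least `1/2`. -/
theorem matWU_le_iff (π : Equiv.Perm (Fin n)) {ρ : ChoiceVec n} (h0 : ∀ p, 0 ≤ ρ p)
    (h1 : ∀ p, ρ p ≤ 1) :
    (∀ i, (matWU π *ᵥ ρ) i ≤ rhsWU π i) ↔ ∀ i j, i < j → 1 / 2 ≤ rule ρ (π i) (π j) := by
  have key : (∀ i, (matWU π *ᵥ ρ) i ≤ rhsWU π i) ↔
      ∀ p, (-ρ p ≤ 1 / 2 - detRule π.symm p ∧ ρ p ≤ 1 / 2 + detRule π.symm p) := by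
    simp only [matWU, rhsWU, Matrix.fromRows_mulVec, Sum.forall, Sum.elim_inl, Sum.elim_inr,
      Matrix.neg_mulVec, Matrix.one_mulVec, Pi.neg_apply, forall_and]
  rw [key]
  constructor
  · intro h i j hij
    rcases (π.injective.ne hij.ne).lt_or_gt with h' | h'
    · rw [rule_of_lt ρ h']
      have := (h ⟨(π i, π j), h'⟩).1
      simp only [detRule, Equiv.symm_apply_apply, hij, if_true] at this
      linarith
    · rw [rule_of_gt ρ h']
      have := (h ⟨(π j, π i), h'⟩).2
      simp only [detRule, Equiv.symm_apply_apply, hij.asymm, if_false] at this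
      linarith
  · intro h p
    rcases (π.symm.injective.ne p.2.ne).lt_or_gt with h' | h'
    · have := h _ _ h'
      simp only [Equiv.apply_symm_apply, rule_pair] at this
      simp only [detRule, h', if_true]
      exact ⟨by linarith, by linarith [h1 p]⟩
    · have := h _ _ h'
      rw [rule_swap] at this
      simp only [Equiv.apply_symm_apply, rule_pair] at this
      simp only [detRule, h'.asymm, if_false]
      exact ⟨by linarith [h0 p], by linarith⟩

theorem mem_polytope_matWU {π : Equiv.Perm (Fin n)} {ρ : ChoiceVec n} :
    ρ ∈ polytope (matWU π) (rhsWU π) ↔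
      (∀ p, 0 ≤ ρ p) ∧ (∀ p, ρ p ≤ 1) ∧ ∀ i j, i < j → 1 / 2 ≤ rule ρ (π i) (π j) := by
  rw [mem_polytope_iff]
  exact and_congr_right fun h0 => and_congr_right fun h1 => matWU_le_iff π h0 h1

theorem mem_polytope_matSS {π : Equiv.Perm (Fin n)} {ρ : ChoiceVec n} :
    ρ ∈ polytope (matSS π) (rhsSS π) ↔
      ρ ∈ polytope (matWU π) (rhsWU π) ∧ ∀ u v w, u < v → v < w →
        rule ρ (π u) (π v) ≤ rule ρ (π u) (π w) ∧ rule ρ (π v) (π w) ≤ rule ρ (π u) (π w) := by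
  simp only [mem_polytope_iff, and_assoc]
  refine and_congr_right fun h0 => and_congr_right fun h1 => ?_
  rw [Sum.forall]
  refine and_congr (by simp [matSS, rhsSS, Matrix.fromRows_mulVec]) ?_
  have hne : ∀ {a b : Fin n}, a < b → π a ≠ π b := fun h => π.injective.ne h.ne
  have key1 : ∀ t : Triple n, (matSS π *ᵥ ρ) (Sum.inr (Sum.inl t)) ≤ rhsSS π (Sum.inr (Sum.inl t)) ↔
      rule ρ (π t.1.1) (π t.1.2.1) ≤ rule ρ (π t.1.1) (π t.1.2.2) := fun t =>
    pairCoeff_sub_le_iff ρ (hne t.2.1) (hne (t.2.1.trans t.2.2))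
  have key2 : ∀ t : Triple n, (matSS π *ᵥ ρ) (Sum.inr (Sum.inr t)) ≤ rhsSS π (Sum.inr (Sum.inr t)) ↔
      rule ρ (π t.1.2.1) (π t.1.2.2) ≤ rule ρ (π t.1.1) (π t.1.2.2) := fun t =>
    pairCoeff_sub_le_iff ρ (hne t.2.2) (hne (t.2.1.trans t.2.2))
  simp only [Sum.forall, key1, key2]
  exact ⟨fun h u v w huv hvw => ⟨h.1 ⟨(u, v, w), huv, hvw⟩, h.2 ⟨(u, v, w), huv, hvw⟩⟩,
    fun h => ⟨fun t => (h _ _ _ t.2.1 t.2.2).1, fun t => (h _ _ _ t.2.1 t.2.2).2⟩⟩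

theorem monotone_of_forall_le_add_one {m : ℕ} {f : Fin m → ℝ}
    (h : ∀ s : Fin (m - 1), f ⟨s.1, by omega⟩ ≤ f ⟨s.1 + 1, by omega⟩) : Monotone f := by
  rcases m with _ | m
  · exact fun i => i.elim0
  · exact Fin.monotone_iff_le_succ.2 fun i => h i

theorem mem_polytope_matMU {π : Equiv.Perm (Fin n)} {τ : ModerateOrder n} {ρ : ChoiceVec n} :
    ρ ∈ polytope (matMU (π, τ)) (rhsMU (π, τ)) ↔
      ρ ∈ polytope (matWU π) (rhsWU π) ∧
        Monotone fun s => rule ρ (π (τ.1 s).1.1) (π (τ.1 s).1.2) := by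
  simp only [mem_polytope_iff, and_assoc]
  refine and_congr_right fun h0 => and_congr_right fun h1 => ?_
  rw [Sum.forall]
  refine and_congr (by simp [matMU, rhsMU, Matrix.fromRows_mulVec]) ?_
  have hne : ∀ p : Pair n, π p.1.1 ≠ π p.1.2 := fun p => π.injective.ne p.2.ne
  have key : ∀ s, (matMU (π, τ) *ᵥ ρ) (Sum.inr s) ≤ rhsMU (π, τ) (Sum.inr s) ↔
      rule ρ (π (τ.lower s).1) (π (τ.lower s).2) ≤
        rule ρ (π (τ.upper s).1) (π (τ.upper s).2) := fun s =>
    pairCoeff_sub_le_iff ρ (hne _) (hne _)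
  simp only [key]
  constructor
  · exact fun h => monotone_of_forall_le_add_one
      (f := fun s => rule ρ (π (τ.1 s).1.1) (π (τ.1 s).1.2)) h
  · intro h s
    exact h (Fin.mk_le_mk.2 (Nat.le_succ _))

end Rule

/-! ### The vectors of a model lie in its polytopes -/

section Necessity

variable {n : ℕ}

theorem exists_perm_antitone (u : Fin n → ℝ) : ∃ π : Equiv.Perm (Fin n), Antitone (u ∘ π) := by
  refine ⟨Tuple.sort fun i => -u i, fun i j hij => ?_⟩
  have := Tuple.monotone_sort (fun i => -u i) hij
  simpa using this

theorem IsSS.exists_mem_polytope {ρ : ChoiceVec n} (h : IsSS ρ) :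
    ∃ π, ρ ∈ polytope (matSS π) (rhsSS π) := by
  obtain ⟨u, F, hF, h1, h2, hs, hr⟩ := h
  obtain ⟨π, hπ⟩ := exists_perm_antitone u
  have half : ∀ a, F a a = 1 / 2 := fun a => by linarith [hs a a]
  refine ⟨π, mem_polytope_matSS.2 ⟨mem_polytope_matWU.2 ⟨fun p => ?_, fun p => ?_,
    fun i j hij => ?_⟩, fun i j k hij hjk => ⟨?_, ?_⟩⟩⟩
  · rw [← rule_pair ρ, hr]; exact (hF _ _).1.le
  · rw [← rule_pair ρ, hr]; exact (hF _ _).2.le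
  · rw [hr, ← half (u (π j))]; exact (h1 _).monotone (hπ hij.le)
  · rw [hr, hr]; exact (h2 _).antitone (hπ hjk.le)
  · rw [hr, hr]; exact (h1 _).monotone (hπ hij.le)

theorem HasDifficultyForm.mem_polytope {c : Fin n → Fin n → ℝ} (hc : IsSemimetric c)
    {ρ : ChoiceVec n} {u : Fin n → ℝ} {F : ℝ → ℝ} (hF : ∀ t, F t ∈ Set.Icc (0 : ℝ) 1)
    (hm : StrictMono F) (hs : ∀ t, F t = 1 - F (-t))
    (hr : ∀ x y, x ≠ y → rule ρ x y = F ((u x - u y) / c x y)) {π : Equiv.Perm (Fin n)}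
    (hπ : Antitone (u ∘ π)) : ρ ∈ polytope (matWU π) (rhsWU π) := by
  refine mem_polytope_matWU.2 ⟨fun p => ?_, fun p => ?_, fun i j hij => ?_⟩
  · rw [← rule_pair ρ, hr _ _ p.2.ne]; exact (hF _).1
  · rw [← rule_pair ρ, hr _ _ p.2.ne]; exact (hF _).2
  · have half : F 0 = 1 / 2 := by have := hs 0; rw [neg_zero] at this; linarith
    rw [hr _ _ (π.injective.ne hij.ne), ← half]
    exact hm.monotone (div_nonneg (sub_nonneg.2 (hπ hij.le)) (hc.nonneg _ _))

theorem IsWU.exists_mem_polytope {ρ : ChoiceVec n} (h : IsWU ρ) :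
    ∃ π, ρ ∈ polytope (matWU π) (rhsWU π) := by
  obtain ⟨c, hc, u, F, hF, hm, hs, hr⟩ := h
  obtain ⟨π, hπ⟩ := exists_perm_antitone u
  exact ⟨π, HasDifficultyForm.mem_polytope hc hF hm hs hr hπ⟩

/-- Sorting all pairs by a value, and by length among pairs of equal value, is compatible with
moderate transitivity of the value. -/
theorem exists_moderateOrder_monotone (f : Pair n → ℝ)
    (hf : ∀ (i j k : Fin n) (hij : i < j) (hjk : j < k),
      min (f ⟨(i, j), hij⟩) (f ⟨(j, k), hjk⟩) ≤ f ⟨(i, k), hij.trans hjk⟩) :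
    ∃ τ : ModerateOrder n, Monotone (f ∘ τ.1) := by
  -- Since `(i, k)` is longer than both `(i, j)` and `(j, k)`, one of these has a strictly smaller
  -- key even when the values tie, so the arbitrary order among equal keys does no harm.
  let key : Pair n → ℝ ×ₗ ℕ := fun p => toLex (f p, (p.1.2 : ℕ) - p.1.1)
  let e : Pair n ≃ Fin (numPairs n) := Fintype.equivFin _
  let τ : Fin (numPairs n) ≃ Pair n := (Tuple.sort (key ∘ e.symm)).trans e.symm
  have hτ : Monotone (key ∘ τ) := Tuple.monotone_sort (key ∘ e.symm)
  have lt_of_key : ∀ {p q}, key p < key q → τ.symm p ≤ τ.symm q := fun {p q} h => by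
    refine (hτ.reflect_lt ?_).le
    simpa using h
  refine ⟨⟨τ, fun i j k hij hjk => ?_⟩, fun s t hst => ?_⟩
  · rw [min_le_iff]
    rcases min_le_iff.1 (hf i j k hij hjk) with h | h
    · refine Or.inl (lt_of_key (Prod.Lex.toLex_lt_toLex.2 ?_))
      rcases h.lt_or_eq with h | h
      · exact Or.inl h
      · exact Or.inr ⟨h, by dsimp only; omega⟩
    · refine Or.inr (lt_of_key (Prod.Lex.toLex_lt_toLex.2 ?_))
      rcases h.lt_or_eq with h | h
      · exact Or.inl h
      · exact Or.inr ⟨h, by dsimp only; omega⟩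
  · rcases (Prod.Lex.toLex_le_toLex.1 (hτ hst)) with h | h
    · exact le_of_lt h
    · exact le_of_eq h.1

/-- The mediant `(a + b) / (x + y)` is at least the smaller fraction, and a denominator `z ≤ x + y`
only helps. With utility differences over distances this is moderate transitivity. -/
theorem min_div_le_add_div_of_le_add {a b x y z : ℝ} (ha : 0 ≤ a) (hb : 0 ≤ b) (hx : 0 < x)
    (hy : 0 < y) (hz : 0 < z) (h : z ≤ x + y) : min (a / x) (b / y) ≤ (a + b) / z := by
  set m := min (a / x) (b / y)
  have h1 : m * x ≤ a := (le_div_iff₀ hx).1 (min_le_left _ _)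
  have h2 : m * y ≤ b := (le_div_iff₀ hy).1 (min_le_right _ _)
  have hm : 0 ≤ m := le_min (by positivity) (by positivity)
  rw [le_div_iff₀ hz]
  nlinarith

theorem IsMU.exists_mem_polytope {ρ : ChoiceVec n} (h : IsMU ρ) :
    ∃ k, ρ ∈ polytope (matMU k) (rhsMU k) := by
  obtain ⟨c, hc, htri, u, F, hF, hm, hs, hr⟩ := h
  obtain ⟨π, hπ⟩ := exists_perm_antitone u
  have hpos : ∀ {i j}, i < j → 0 < c (π i) (π j) := fun h =>
    (hc.nonneg _ _).lt_of_ne' fun h0 => h.ne (π.injective ((hc.eq_zero_iff _ _).1 h0))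
  obtain ⟨τ, hτ⟩ := exists_moderateOrder_monotone
    (fun p : Pair n => rule ρ (π p.1.1) (π p.1.2)) fun i j k hij hjk => by
      have hne : ∀ {a b : Fin n}, a < b → π a ≠ π b := fun h => π.injective.ne h.ne
      simp only [hr _ _ (hne hij), hr _ _ (hne hjk), hr _ _ (hne (hij.trans hjk)),
        ← hm.monotone.map_min]
      refine hm.monotone ?_
      have := min_div_le_add_div_of_le_add (sub_nonneg.2 (hπ hij.le)) (sub_nonneg.2 (hπ hjk.le))
        (hpos hij) (hpos hjk) (hpos (hij.trans hjk)) (htri _ _ _)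
      simpa using this
  exact ⟨(π, τ), mem_polytope_matMU.2 ⟨HasDifficultyForm.mem_polytope hc hF hm hs hr hπ, hτ⟩⟩

end Necessity

end StochasticChoice

namespace StochasticChoice

/-! ### The polytopes of a model lie in the closure of its vectors -/

/-- A function on a finite index set which is monotone for a family of points in a preorder, and
skew symmetric for an antitone involution, extends from these points to the preorder. -/
theorem exists_monotone_skew_extension {α β : Type*} [Finite α] [Preorder β] {inv : β → β}
    (hinv : Antitone inv) (hii : ∀ t, inv (inv t) = t) {q : α → β} {f : α → ℝ}
    (hf : ∀ a, f a ∈ Set.Icc (0 : ℝ) 1) (hmono : ∀ a b, q a ≤ q b → f a ≤ f b)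
    (hskew : ∀ a, ∃ b, q b = inv (q a) ∧ f b = 1 - f a) :
    ∃ G : β → ℝ, Monotone G ∧ (∀ t, G t ∈ Set.Icc (0 : ℝ) 1) ∧ (∀ t, G t = 1 - G (inv t)) ∧
      ∀ a, G (q a) = f a := by
  classical
  -- The least nonnegative monotone extension: the largest value at a point below `t`, and `0` if
  -- there is none.
  let h : β → ℝ := fun t => ⨆ a, if q a ≤ t then f a else 0
  have bdd : ∀ t, BddAbove (Set.range fun a => if q a ≤ t then f a else 0) := fun t =>
    Set.Finite.bddAbove (Set.finite_range _)
  have hm : Monotone h := fun s t hst => by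
    refine ciSup_mono (bdd t) fun a => ?_
    by_cases hs : q a ≤ s
    · simp only [hs, hs.trans hst, if_true, le_refl]
    · simp only [hs, if_false]
      split_ifs
      exacts [(hf a).1, le_rfl]
  have h0 : ∀ t, 0 ≤ h t := fun t => Real.iSup_nonneg fun a => by
    split_ifs
    exacts [(hf a).1, le_rfl]
  have h1 : ∀ t, h t ≤ 1 := fun t => Real.iSup_le (fun a => by
    split_ifs
    exacts [(hf a).2, zero_le_one]) zero_le_one
  have hq : ∀ a, h (q a) = f a := fun a => by
    apply le_antisymm
    · refine Real.iSup_le (fun b => ?_) (hf a).1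
      split_ifs with hb
      exacts [hmono b a hb, (hf a).1]
    · refine le_ciSup_of_le (bdd _) a ?_
      simp
  -- Averaging `h` with its reflection `1 - h ∘ inv` enforces skew symmetry and keeps the values `f
  -- a`, which are already skew.
  refine ⟨fun t => (h t + 1 - h (inv t)) / 2, fun s t hst => ?_, fun t => ⟨?_, ?_⟩, fun t => ?_,
    fun a => ?_⟩
  · have := hm hst
    have := hm (hinv hst)
    dsimp only
    linarith
  · linarith [h0 t, h1 (inv t)]
  · linarith [h1 t, h0 (inv t)]
  · simp only [hii]; ring
  · obtain ⟨b, hb, hfb⟩ := hskew a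
    simp only [← hb, hq, hfb]; ring

/-! ### Strictly monotone perturbations. -/

variable {n : ℕ}

theorem mem_closure_of_forall_combo_mem {S : Set (ChoiceVec n)} {ρ σ : ChoiceVec n}
    (h : ∀ t : ℝ, 0 < t → t < 1 → (1 - t) • ρ + t • σ ∈ S) : ρ ∈ closure S := by
  have hc : Continuous fun t : ℝ => (1 - t) • ρ + t • σ := by fun_prop
  have ht : Filter.Tendsto (fun t : ℝ => (1 - t) • ρ + t • σ) (nhdsWithin 0 (Set.Ioi 0))
      (nhds ρ) := by
    simpa using (hc.tendsto 0).mono_left nhdsWithin_le_nhds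
  refine mem_closure_of_tendsto ht ?_
  filter_upwards [Ioo_mem_nhdsGT (zero_lt_one' ℝ)] with t h'
  exact h t h'.1 h'.2

theorem combo_mem_Ioo {t g s : ℝ} (h0 : 0 < t) (h1 : t < 1) (hg : g ∈ Set.Icc (0 : ℝ) 1)
    (hs : s ∈ Set.Ioo (0 : ℝ) 1) : (1 - t) * g + t * s ∈ Set.Ioo (0 : ℝ) 1 := by
  obtain ⟨hg0, hg1⟩ := hg
  obtain ⟨hs0, hs1⟩ := hs
  constructor
  · have := mul_pos h0 hs0
    have := mul_nonneg (sub_nonneg.2 h1.le) hg0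
    linarith
  · have := mul_pos h0 (sub_pos.2 hs1)
    have := mul_nonneg (sub_nonneg.2 h1.le) (sub_nonneg.2 hg1)
    linarith

theorem strictMono_combo {β : Type*} [Preorder β] {g s : β → ℝ} (hg : Monotone g)
    (hs : StrictMono s) {t : ℝ} (h0 : 0 < t) (h1 : t < 1) :
    StrictMono fun x => (1 - t) * g x + t * s x := fun _ _ hxy =>
  add_lt_add_of_le_of_lt (mul_le_mul_of_nonneg_left (hg hxy.le) (sub_nonneg.2 h1.le))
    (mul_lt_mul_of_pos_left (hs hxy) h0)

theorem sigmoid_mem_Ioo (t : ℝ) : t.sigmoid ∈ Set.Ioo (0 : ℝ) 1 :=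
  ⟨t.sigmoid_pos, t.sigmoid_lt_one⟩

theorem mem_closure_isSS_of_monotone {ρ : ChoiceVec n} (h0 : ∀ p, 0 ≤ ρ p) (h1 : ∀ p, ρ p ≤ 1)
    {u : Fin n → ℝ}
    (hmono : ∀ x y x' y', u x ≤ u x' → u y' ≤ u y → rule ρ x y ≤ rule ρ x' y') :
    ρ ∈ closure {r : ChoiceVec n | IsSS r} := by
  -- Monotone on `ℝ × ℝᵒᵈ` means increasing in the first and decreasing in the second argument; the
  -- involution exchanges the two arguments.
  obtain ⟨G, hGm, hG, hGs, hGq⟩ := exists_monotone_skew_extension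
    (β := ℝ × ℝᵒᵈ) (inv := fun z => (OrderDual.ofDual z.2, OrderDual.toDual z.1))
    (fun _ _ h => Prod.mk_le_mk.2 ⟨h.2, h.1⟩) (fun _ => rfl)
    (q := fun a : Fin n × Fin n => (u a.1, OrderDual.toDual (u a.2)))
    (f := fun a => rule ρ a.1 a.2) (fun a => rule_mem_Icc h0 h1 _ _)
    (fun a b h => hmono _ _ _ _ (Prod.mk_le_mk.1 h).1 (Prod.mk_le_mk.1 h).2) (fun a => ⟨(a.2, a.1), rfl, rule_swap ρ _ _⟩)
  let s : ℝ → ℝ → ℝ := fun a b => 1 / 2 + (a.sigmoid - b.sigmoid) / 2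
  have hs : ∀ a b, s a b ∈ Set.Ioo (0 : ℝ) 1 := fun a b => by
    have := sigmoid_mem_Ioo a
    have := sigmoid_mem_Ioo b
    simp only [Set.mem_Ioo, s] at *
    constructor <;> linarith
  have hsl : ∀ b, StrictMono fun a => s a b := fun b a a' h => by
    have := Real.sigmoid_strictMono h
    dsimp only [s]
    linarith
  have hss : ∀ a b, s a b = 1 - s b a := fun a b => by simp only [s]; ring
  refine mem_closure_of_forall_combo_mem (σ := fun p => s (u p.1.1) (u p.1.2)) fun t ht0 ht1 => ?_
  have hFs : ∀ a b, (1 - t) * G (a, OrderDual.toDual b) + t * s a b =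
      1 - ((1 - t) * G (b, OrderDual.toDual a) + t * s b a) := fun a b => by
    rw [hss a b, hGs (a, OrderDual.toDual b)]
    simp only [OrderDual.ofDual_toDual]
    ring
  have hFm : ∀ b, StrictMono fun a => (1 - t) * G (a, OrderDual.toDual b) + t * s a b := fun b =>
    strictMono_combo (g := fun a => G (a, OrderDual.toDual b))
      (fun a a' h => hGm (Prod.mk_le_mk.2 ⟨h, le_rfl⟩)) (hsl b) ht0 ht1
  refine ⟨u, fun a b => (1 - t) * G (a, OrderDual.toDual b) + t * s a b,
    fun a b => combo_mem_Ioo ht0 ht1 (hG _) (hs a b), hFm, fun a b b' h => ?_, hFs,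
    fun x y => ?_⟩
  · have := hFm a h
    dsimp only at this ⊢
    rw [hFs a b, hFs a b']
    linarith
  · have hG' := hGq (x, y)
    dsimp only at hG' ⊢
    rw [rule_combo, hG']
    rcases eq_or_ne x y with rfl | hxy
    · simp [rule_self, s]
    · rw [rule_eq_of_skew (ρ := fun p : Pair n => s (u p.1.1) (u p.1.2))
        (f := fun x y => s (u x) (u y)) (fun _ _ _ => hss _ _) (fun _ => rfl) hxy]

/-- A vector is a limit of vectors of difficulty form for `u` and `c`, if it weakly increases with
the ratios `(u x - u y) / c x y`. -/
theorem mem_closure_hasDifficultyForm_of_monotone {ρ : ChoiceVec n} (h0 : ∀ p, 0 ≤ ρ p)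
    (h1 : ∀ p, ρ p ≤ 1) {u : Fin n → ℝ} {c : Fin n → Fin n → ℝ} (hc : ∀ x y, c x y = c y x)
    (hmono : ∀ x y x' y', x ≠ y → x' ≠ y' → (u x - u y) / c x y ≤ (u x' - u y') / c x' y' →
      rule ρ x y ≤ rule ρ x' y') :
    ρ ∈ closure {r : ChoiceVec n | HasDifficultyForm c r} := by
  have hq : ∀ x y, (u y - u x) / c y x = -((u x - u y) / c x y) := fun x y => by
    rw [hc y x, ← neg_div, neg_sub]
  obtain ⟨G, hGm, hG, hGs, hGq⟩ := exists_monotone_skew_extension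
    (β := ℝ) (inv := fun z => -z) (fun _ _ h => neg_le_neg h) neg_neg
    -- Only off-diagonal pairs are interpolated, since `HasDifficultyForm` imposes nothing on the
    -- diagonal.
    (q := fun a : {a : Fin n × Fin n // a.1 ≠ a.2} => (u a.1.1 - u a.1.2) / c a.1.1 a.1.2)
    (f := fun a => rule ρ a.1.1 a.1.2) (fun a => rule_mem_Icc h0 h1 _ _)
    (fun a b h => hmono _ _ _ _ a.2 b.2 h)
    (fun a => ⟨⟨(a.1.2, a.1.1), a.2.symm⟩, hq _ _, rule_swap ρ _ _⟩)
  refine mem_closure_of_forall_combo_mem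
    (σ := fun p => ((u p.1.1 - u p.1.2) / c p.1.1 p.1.2).sigmoid) fun t ht0 ht1 => ?_
  refine ⟨u, fun z => (1 - t) * G z + t * z.sigmoid,
    fun z => Set.Ioo_subset_Icc_self (combo_mem_Ioo ht0 ht1 (hG z) (sigmoid_mem_Ioo z)),
    strictMono_combo hGm Real.sigmoid_strictMono ht0 ht1, fun z => ?_, fun x y hxy => ?_⟩
  · simp only [hGs z, Real.sigmoid_neg]; ring
  · have hG' := hGq ⟨(x, y), hxy⟩
    dsimp only at hG' ⊢
    rw [rule_combo, hG',
      rule_eq_of_skew (f := fun x y => ((u x - u y) / c x y).sigmoid)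
      (fun x y _ => by rw [hq, Real.sigmoid_neg]) (fun _ => rfl) hxy]

/-- To compare choice probabilities with ratios of skew symmetric sign, it suffices to compare
those pairs in which the preferred option comes first. -/
theorem rule_le_rule_of_le {π : Equiv.Perm (Fin n)} {ρ : ChoiceVec n}
    (hρ : ρ ∈ polytope (matWU π) (rhsWU π)) {q : Fin n → Fin n → ℝ} (hq : ∀ x y, q y x = -q x y)
    (hpos : ∀ i j, i < j → 0 < q (π i) (π j))
    (hmono : ∀ i j i' j', i < j → i' < j' → q (π i) (π j) ≤ q (π i') (π j') →
      rule ρ (π i) (π j) ≤ rule ρ (π i') (π j')) {x y x' y' : Fin n} (hxy : x ≠ y)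
    (hxy' : x' ≠ y') (h : q x y ≤ q x' y') : rule ρ x y ≤ rule ρ x' y' := by
  have half := (mem_polytope_matWU.1 hρ).2.2
  obtain ⟨i, rfl⟩ := π.surjective x
  obtain ⟨j, rfl⟩ := π.surjective y
  obtain ⟨i', rfl⟩ := π.surjective x'
  obtain ⟨j', rfl⟩ := π.surjective y'
  -- Preferred-first pairs have positive ratio and probability at least `1/2`, reversed pairs the
  -- opposite; so one mixed case is contradictory and the other passes through `1/2`.
  rcases (ne_of_apply_ne π hxy).lt_or_gt with hij | hij <;>
    rcases (ne_of_apply_ne π hxy').lt_or_gt with hij' | hij'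
  · exact hmono _ _ _ _ hij hij' h
  · have := hpos _ _ hij
    have := hpos _ _ hij'
    rw [hq (π j') (π i')] at h
    linarith
  · rw [rule_swap ρ (π j) (π i)]
    linarith [half _ _ hij, half _ _ hij']
  · rw [rule_swap ρ (π j) (π i), rule_swap ρ (π j') (π i')]
    rw [hq (π j) (π i), hq (π j') (π i')] at h
    linarith [hmono _ _ _ _ hij' hij (neg_le_neg_iff.1 h)]

/-- The utility of an option that is given by its rank in a preference. -/
noncomputable def rankUtility (π : Equiv.Perm (Fin n)) (x : Fin n) : ℝ := -((π.symm x : ℕ) : ℝ)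

theorem rankUtility_apply (π : Equiv.Perm (Fin n)) (i : Fin n) :
    rankUtility π (π i) = -((i : ℕ) : ℝ) := by
  simp [rankUtility]

theorem rankUtility_le_iff {π : Equiv.Perm (Fin n)} {i j : Fin n} :
    rankUtility π (π i) ≤ rankUtility π (π j) ↔ j ≤ i := by
  simp [rankUtility_apply]

theorem rankUtility_lt_iff {π : Equiv.Perm (Fin n)} {i j : Fin n} :
    rankUtility π (π i) < rankUtility π (π j) ↔ j < i := by
  simp [rankUtility_apply]

theorem rankUtility_injective (π : Equiv.Perm (Fin n)) : Function.Injective (rankUtility π) :=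
  fun x y h => π.symm.injective (Fin.ext (by simpa [rankUtility] using h))

theorem isSemimetric_of_pos {c : Fin n → Fin n → ℝ} (hd : ∀ x, c x x = 0)
    (hs : ∀ x y, c x y = c y x) (hpos : ∀ x y, x ≠ y → 0 < c x y) : IsSemimetric c := by
  refine ⟨fun x y => ?_, fun x y => ⟨fun h => by_contra fun hne => (hpos x y hne).ne' h, ?_⟩, hs⟩
  · rcases eq_or_ne x y with rfl | h
    exacts [(hd x).ge, (hpos x y h).le]
  · rintro rfl
    exact hd x

theorem mem_closure_isWU {π : Equiv.Perm (Fin n)} {ρ : ChoiceVec n}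
    (hρ : ρ ∈ polytope (matWU π) (rhsWU π)) : ρ ∈ closure {r : ChoiceVec n | IsWU r} := by
  obtain ⟨h0, h1, half⟩ := mem_polytope_matWU.1 hρ
  let u := rankUtility π
  -- The ratios to be realized by `c`. The sign term keeps them nonzero, with the sign of `u x - u
  -- y`, even where the probability is `1/2`; thus `c` below is positive off the diagonal.
  let q : Fin n → Fin n → ℝ := fun x y => rule ρ x y - 1 / 2 + SignType.sign (u x - u y)
  have hqs : ∀ x y, q y x = -q x y := fun x y => by
    have : u y - u x = -(u x - u y) := by ring
    simp only [q, rule_swap ρ x y, this, Left.sign_neg, SignType.coe_neg]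
    ring
  have hq : ∀ {i j}, i < j → q (π i) (π j) = rule ρ (π i) (π j) + 1 / 2 := fun {i j} hij => by
    have : 0 < u (π i) - u (π j) := sub_pos.2 (rankUtility_lt_iff.2 hij)
    simp only [q, sign_pos this, SignType.coe_one]
    ring
  have hpos : ∀ i j, i < j → 0 < q (π i) (π j) := fun i j hij => by
    rw [hq hij]
    linarith [half i j hij]
  let c : Fin n → Fin n → ℝ := fun x y => (u x - u y) / q x y
  have hcs : ∀ x y, c x y = c y x := fun x y => by
    simp only [c, hqs x y]
    rw [div_neg, ← neg_div, neg_sub]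
  have hcpos : ∀ x y, x ≠ y → 0 < c x y := fun x y hxy => by
    obtain ⟨i, rfl⟩ := π.surjective x
    obtain ⟨j, rfl⟩ := π.surjective y
    rcases (ne_of_apply_ne π hxy).lt_or_gt with hij | hij
    · exact div_pos (sub_pos.2 (rankUtility_lt_iff.2 hij)) (hpos _ _ hij)
    · rw [hcs]
      exact div_pos (sub_pos.2 (rankUtility_lt_iff.2 hij)) (hpos _ _ hij)
  have hcd : ∀ x, c x x = 0 := fun x => by simp [c]
  have hratio : ∀ x y, x ≠ y → (u x - u y) / c x y = q x y := fun x y hxy =>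
    div_div_cancel₀ (sub_ne_zero.2 ((rankUtility_injective π).ne hxy))
  have hsub : {r : ChoiceVec n | HasDifficultyForm c r} ⊆ {r | IsWU r} := fun r hr =>
    ⟨c, isSemimetric_of_pos hcd hcs hcpos, hr⟩
  refine closure_mono hsub
    (mem_closure_hasDifficultyForm_of_monotone h0 h1 (u := u) hcs ?_)
  intro x y x' y' hxy hxy' h
  rw [hratio x y hxy, hratio x' y' hxy'] at h
  refine rule_le_rule_of_le hρ hqs hpos (fun i j i' j' hij hij' h => ?_) hxy hxy' h
  rw [hq hij, hq hij'] at h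
  linarith

/-- The inequalities of the system cover `i` ranked before `j`, and by skew symmetry `i` ranked
after `k`; if `i` lies between them, the comparison passes through `1/2`. -/
theorem rule_mono_right_of_mem_matSS {π : Equiv.Perm (Fin n)} {ρ : ChoiceVec n}
    (hρ : ρ ∈ polytope (matSS π) (rhsSS π)) (i : Fin n) {j k : Fin n} (hjk : j ≤ k) :
    rule ρ (π i) (π j) ≤ rule ρ (π i) (π k) := by
  obtain ⟨hW, hS⟩ := mem_polytope_matSS.1 hρ
  have half := (mem_polytope_matWU.1 hW).2.2
  have low : ∀ {a b}, a ≤ b → rule ρ (π b) (π a) ≤ 1 / 2 := fun {a b} hab => by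
    rcases hab.eq_or_lt with rfl | hab
    · rw [rule_self]
    · rw [rule_swap]; linarith [half _ _ hab]
  have high : ∀ {a b}, a ≤ b → 1 / 2 ≤ rule ρ (π a) (π b) := fun {a b} hab => by
    rw [rule_swap]; linarith [low hab]
  rcases hjk.eq_or_lt with rfl | hjk
  · rfl
  rcases lt_or_ge i j with hij | hij
  · exact (hS i j k hij hjk).1
  rcases le_or_gt i k with hik | hik
  · exact (low hij).trans (high hik)
  · rw [rule_swap ρ (π j), rule_swap ρ (π k)]
    linarith [(hS j k i hjk hik).2]

theorem mem_closure_isSS {π : Equiv.Perm (Fin n)} {ρ : ChoiceVec n}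
    (hρ : ρ ∈ polytope (matSS π) (rhsSS π)) : ρ ∈ closure {r : ChoiceVec n | IsSS r} := by
  obtain ⟨h0, h1, -⟩ := mem_polytope_matWU.1 (mem_polytope_matSS.1 hρ).1
  refine mem_closure_isSS_of_monotone h0 h1 (u := rankUtility π) fun x y x' y' hx hy => ?_
  obtain ⟨i, rfl⟩ := π.surjective x
  obtain ⟨j, rfl⟩ := π.surjective y
  obtain ⟨i', rfl⟩ := π.surjective x'
  obtain ⟨j', rfl⟩ := π.surjective y'
  rw [rankUtility_le_iff] at hx hy
  refine (rule_mono_right_of_mem_matSS hρ i hy).trans ?_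
  rw [rule_swap ρ (π j'), rule_swap ρ (π j')]
  linarith [rule_mono_right_of_mem_matSS hρ j' hx]

end StochasticChoice

namespace StochasticChoice

/-! ### A metric for a given moderate ordering -/

namespace ModerateOrder

variable {n : ℕ} (τ : ModerateOrder n)

/-- A weight which decreases geometrically along the ordering. -/
noncomputable def weight (i j : Fin n) : ℝ :=
  -- The base is below `1/n`, and `n` bounds all differences of positions, so a later weight times
  -- any such difference is at most an earlier weight. The shift by one in the exponent gives `n *
  -- weight ≤ 1` already at position `0`.
  if h : i < j then ((n : ℝ) + 1)⁻¹ ^ ((τ.1.symm ⟨(i, j), h⟩ : ℕ) + 1) else 0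

theorem weight_nonneg (i j : Fin n) : 0 ≤ τ.weight i j := by
  unfold weight
  split_ifs
  exacts [by positivity, le_rfl]

theorem weight_of_le {i j : Fin n} (h : j ≤ i) : τ.weight i j = 0 := dif_neg h.not_gt

theorem base_lt_one (hn : 0 < n) : ((n : ℝ) + 1)⁻¹ < 1 :=
  inv_lt_one_of_one_lt₀ (by simpa using hn)

theorem mul_base_pow_succ_le (a : ℕ) :
    (n : ℝ) * ((n : ℝ) + 1)⁻¹ ^ (a + 1) ≤ ((n : ℝ) + 1)⁻¹ ^ a := by
  rw [pow_succ, mul_left_comm]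
  refine mul_le_of_le_one_right (by positivity) ?_
  rw [← div_eq_mul_inv, div_le_one (by positivity)]
  linarith

theorem mul_weight_le_one (i j : Fin n) : (n : ℝ) * τ.weight i j ≤ 1 := by
  unfold weight
  split_ifs with h
  · exact (mul_base_pow_succ_le _).trans
      (pow_le_one₀ (by positivity) (base_lt_one (Fin.pos i)).le)
  · simp

theorem weight_le_weight_iff {i j i' j' : Fin n} (h : i < j) (h' : i' < j') :
    τ.weight i j ≤ τ.weight i' j' ↔ τ.1.symm ⟨(i', j'), h'⟩ ≤ τ.1.symm ⟨(i, j), h⟩ := by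
  rw [weight, weight, dif_pos h, dif_pos h',
    pow_le_pow_iff_right_of_lt_one₀ (by positivity) (base_lt_one (Fin.pos i))]
  simp

theorem mul_weight_le_weight {i j i' j' : Fin n} (h : i < j) (h' : i' < j')
    (hlt : τ.1.symm ⟨(i', j'), h'⟩ < τ.1.symm ⟨(i, j), h⟩) :
    (n : ℝ) * τ.weight i j ≤ τ.weight i' j' := by
  rw [weight, weight, dif_pos h, dif_pos h']
  refine (mul_base_pow_succ_le _).trans ?_
  exact pow_le_pow_of_le_one (by positivity) (base_lt_one (Fin.pos i)).le hlt

/-- Compatibility of `τ` places `(i, k)` after one of the shorter pairs, strictly because the pairs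
differ; one step along `τ` gains the factor `n`. -/
theorem mul_weight_le {i j k : Fin n} (hij : i < j) (hjk : j < k) :
    (n : ℝ) * τ.weight i k ≤ τ.weight i j ∨ (n : ℝ) * τ.weight i k ≤ τ.weight j k := by
  have hne : ∀ p q : Pair n, p.1 ≠ q.1 → τ.1.symm p ≠ τ.1.symm q := fun p q h h' =>
    h (congrArg Subtype.val (τ.1.symm.injective h'))
  rcases min_le_iff.1 (τ.2 i j k hij hjk) with h | h
  · refine Or.inl (τ.mul_weight_le_weight _ _ (h.lt_of_ne (hne _ _ fun he => ?_)))
    exact hjk.ne (congrArg Prod.snd he)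
  · refine Or.inr (τ.mul_weight_le_weight _ _ (h.lt_of_ne (hne _ _ fun he => ?_)))
    exact hij.ne' (congrArg Prod.fst he)

/-- The distance of two positions, distorted in such a way that the speed at which it is passed
increases along the ordering. -/
noncomputable def dist (i j : Fin n) : ℝ :=
  |((i : ℕ) : ℝ) - ((j : ℕ) : ℝ)| * (1 + τ.weight i j + τ.weight j i)

theorem dist_self (i : Fin n) : τ.dist i i = 0 := by simp [dist]

theorem dist_comm (i j : Fin n) : τ.dist i j = τ.dist j i := by
  rw [dist, dist, abs_sub_comm]; ring

theorem dist_of_lt {i j : Fin n} (h : i < j) :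
    τ.dist i j = (((j : ℕ) : ℝ) - ((i : ℕ) : ℝ)) * (1 + τ.weight i j) := by
  have : ((i : ℕ) : ℝ) < ((j : ℕ) : ℝ) := by exact_mod_cast h
  rw [dist, τ.weight_of_le h.le, abs_sub_comm, abs_of_pos (sub_pos.2 this), add_zero]

theorem dist_pos {i j : Fin n} (h : i ≠ j) : 0 < τ.dist i j := by
  have h1 : ((i : ℕ) : ℝ) ≠ ((j : ℕ) : ℝ) := by simpa [Fin.ext_iff] using h
  have := τ.weight_nonneg i j
  have := τ.weight_nonneg j i
  exact mul_pos (abs_pos.2 (sub_ne_zero.2 h1)) (by linarith)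

/-- With `a = j - i` and `b = k - j`, the undistorted lengths cancel in the first inequality, and
the excess `(a + b) * weight i k` is at most `weight i j` or `weight j k` by `mul_weight_le`. In the
other two, the excess of the left side is at most `1`, which the undistorted length of the other
short side covers. -/
theorem dist_triangle_of_lt {i j k : Fin n} (hij : i < j) (hjk : j < k) :
    τ.dist i k ≤ τ.dist i j + τ.dist j k ∧ τ.dist i j ≤ τ.dist i k + τ.dist j k ∧
      τ.dist j k ≤ τ.dist i k + τ.dist i j := by
  rw [τ.dist_of_lt hij, τ.dist_of_lt hjk, τ.dist_of_lt (hij.trans hjk)]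
  have ha : (1 : ℝ) ≤ ((j : ℕ) : ℝ) - ((i : ℕ) : ℝ) := by
    rw [le_sub_iff_add_le']; exact_mod_cast hij
  have hb : (1 : ℝ) ≤ ((k : ℕ) : ℝ) - ((j : ℕ) : ℝ) := by
    rw [le_sub_iff_add_le']; exact_mod_cast hjk
  have hN : ((k : ℕ) : ℝ) - ((i : ℕ) : ℝ) ≤ n := by
    have h1 : ((k : ℕ) : ℝ) ≤ n := by exact_mod_cast k.2.le
    have h2 : (0 : ℝ) ≤ ((i : ℕ) : ℝ) := by positivity
    linarith
  have hac : ((k : ℕ) : ℝ) - ((i : ℕ) : ℝ) =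
    (((j : ℕ) : ℝ) - ((i : ℕ) : ℝ)) + (((k : ℕ) : ℝ) - ((j : ℕ) : ℝ)) := by ring
  rw [hac] at hN ⊢
  generalize ((j : ℕ) : ℝ) - ((i : ℕ) : ℝ) = a at *
  generalize ((k : ℕ) : ℝ) - ((j : ℕ) : ℝ) = b at *
  have e1 := τ.weight_nonneg i j
  have e2 := τ.weight_nonneg j k
  have e3 := τ.weight_nonneg i k
  have l1 := τ.mul_weight_le_one i j
  have l2 := τ.mul_weight_le_one j k
  have m1 : a * τ.weight i j ≤ n * τ.weight i j := mul_le_mul_of_nonneg_right (by linarith) e1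
  have m2 : b * τ.weight j k ≤ n * τ.weight j k := mul_le_mul_of_nonneg_right (by linarith) e2
  have m3 : (a + b) * τ.weight i k ≤ n * τ.weight i k := mul_le_mul_of_nonneg_right hN e3
  have p1 : τ.weight i j ≤ a * τ.weight i j := le_mul_of_one_le_left e1 ha
  have p2 : τ.weight j k ≤ b * τ.weight j k := le_mul_of_one_le_left e2 hb
  have p3 : 0 ≤ (a + b) * τ.weight i k := mul_nonneg (by linarith) e3
  refine ⟨?_, by linarith, by linarith⟩
  rcases τ.mul_weight_le hij hjk with h | h <;> linarith

theorem dist_triangle (i j k : Fin n) : τ.dist i k ≤ τ.dist i j + τ.dist j k := by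
  have nonneg : ∀ a b, 0 ≤ τ.dist a b := fun a b => by
    rcases eq_or_ne a b with rfl | h
    exacts [(τ.dist_self a).ge, (τ.dist_pos h).le]
  have c1 := τ.dist_comm i j
  have c2 := τ.dist_comm j k
  have c3 := τ.dist_comm i k
  rcases lt_trichotomy i j with hij | rfl | hij
  · rcases lt_trichotomy j k with hjk | rfl | hjk
    · exact (τ.dist_triangle_of_lt hij hjk).1
    · rw [τ.dist_self, add_zero]
    · rcases lt_trichotomy i k with hik | rfl | hik
      · linarith [(τ.dist_triangle_of_lt hik hjk).2.1]
      · rw [τ.dist_self]; linarith [nonneg i j, nonneg j i]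
      · linarith [(τ.dist_triangle_of_lt hik hij).2.1]
  · rw [τ.dist_self, zero_add]
  · rcases lt_trichotomy j k with hjk | rfl | hjk
    · rcases lt_trichotomy i k with hik | rfl | hik
      · linarith [(τ.dist_triangle_of_lt hij hik).2.2]
      · rw [τ.dist_self]; linarith [nonneg i j, nonneg j i]
      · linarith [(τ.dist_triangle_of_lt hjk hik).2.2]
    · rw [τ.dist_self, add_zero]
    · linarith [(τ.dist_triangle_of_lt hjk hij).1]

end ModerateOrder

/-! ### Sufficiency for Moderate Utility, and the closures of the three models. -/

variable {n : ℕ}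

theorem mem_closure_isMU {k : Equiv.Perm (Fin n) × ModerateOrder n} {ρ : ChoiceVec n}
    (hρ : ρ ∈ polytope (matMU k) (rhsMU k)) : ρ ∈ closure {r : ChoiceVec n | IsMU r} := by
  obtain ⟨π, τ⟩ := k
  obtain ⟨hW, hτ⟩ := mem_polytope_matMU.1 hρ
  obtain ⟨h0, h1, -⟩ := mem_polytope_matWU.1 hW
  let c : Fin n → Fin n → ℝ := fun x y => τ.dist (π.symm x) (π.symm y)
  have hcs : ∀ x y, c x y = c y x := fun x y => τ.dist_comm _ _
  have hc : IsSemimetric c := isSemimetric_of_pos (fun x => τ.dist_self _) hcs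
    fun x y h => τ.dist_pos (π.symm.injective.ne h)
  have hsub : {r : ChoiceVec n | HasDifficultyForm c r} ⊆ {r | IsMU r} := fun r hr =>
    ⟨c, hc, fun x y z => τ.dist_triangle _ _ _, hr⟩
  refine closure_mono hsub
    (mem_closure_hasDifficultyForm_of_monotone h0 h1 (u := rankUtility π) hcs ?_)
  have hw : ∀ i j, 0 < 1 + τ.weight i j := fun i j => by linarith [τ.weight_nonneg i j]
  -- The rank difference cancels the undistorted length. What remains strictly increases along `τ`,
  -- so comparing ratios is comparing positions in `τ`.
  have hq : ∀ i j, i < j → (rankUtility π (π i) - rankUtility π (π j)) / c (π i) (π j) =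
      1 / (1 + τ.weight i j) := fun i j hij => by
    have : (0 : ℝ) < ((j : ℕ) : ℝ) - ((i : ℕ) : ℝ) := sub_pos.2 (by exact_mod_cast hij)
    simp only [c, Equiv.symm_apply_apply, rankUtility_apply, τ.dist_of_lt hij, neg_sub_neg]
    rw [div_mul_eq_div_div, div_self this.ne']
  intro x y x' y' hxy hxy' h
  refine rule_le_rule_of_le hW (q := fun x y => (rankUtility π x - rankUtility π y) / c x y)
    (fun x y => ?_) (fun i j hij => ?_) (fun i j i' j' hij hij' h => ?_) hxy hxy' h
  · rw [hcs y x, ← neg_div, neg_sub]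
  · rw [hq i j hij]
    exact one_div_pos.2 (hw i j)
  · rw [hq i j hij, hq i' j' hij', one_div_le_one_div (hw _ _) (hw _ _), add_le_add_iff_left,
      τ.weight_le_weight_iff hij' hij] at h
    simpa using hτ h

theorem closure_isSS (n : ℕ) :
    closure {r : ChoiceVec n | IsSS r} = ⋃ π, polytope (matSS π) (rhsSS π) := by
  refine (closure_minimal (fun r hr => Set.mem_iUnion.2 hr.exists_mem_polytope) ?_).antisymm
    (Set.iUnion_subset fun π r hr => mem_closure_isSS hr)
  exact isClosed_iUnion_of_finite fun π => (isCompact_polytope _ _).isClosed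

theorem closure_isMU (n : ℕ) :
    closure {r : ChoiceVec n | IsMU r} = ⋃ k, polytope (matMU k) (rhsMU k) := by
  refine (closure_minimal (fun r hr => Set.mem_iUnion.2 hr.exists_mem_polytope) ?_).antisymm
    (Set.iUnion_subset fun π r hr => mem_closure_isMU hr)
  exact isClosed_iUnion_of_finite fun π => (isCompact_polytope _ _).isClosed

theorem closure_isWU (n : ℕ) :
    closure {r : ChoiceVec n | IsWU r} = ⋃ π, polytope (matWU π) (rhsWU π) := by
  refine (closure_minimal (fun r hr => Set.mem_iUnion.2 hr.exists_mem_polytope) ?_).antisymm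
    (Set.iUnion_subset fun π r hr => mem_closure_isWU hr)
  exact isClosed_iUnion_of_finite fun π => (isCompact_polytope _ _).isClosed

end StochasticChoice

theorem theorem1 (n : ℕ) :
    ((verticesSS n).Finite ∧ (verticesMU n).Finite ∧ (verticesWU n).Finite) ∧
    ∀ ρ : ChoiceVec n, (∀ p, ρ p ∈ Set.Icc (0 : ℝ) 1) →
      [ρ ∈ closure (collective {r : ChoiceVec n | IsSS r}),
        ρ ∈ collective (closure {r : ChoiceVec n | IsSS r}),
        ρ ∈ convexHull ℝ (verticesSS n),
        LiftedFeasible matSS rhsSS ρ].TFAE ∧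
      [ρ ∈ closure (collective {r : ChoiceVec n | IsMU r}),
        ρ ∈ collective (closure {r : ChoiceVec n | IsMU r}),
        ρ ∈ convexHull ℝ (verticesMU n),
        LiftedFeasible matMU rhsMU ρ].TFAE ∧
      [ρ ∈ closure (collective {r : ChoiceVec n | IsWU r}),
        ρ ∈ collective (closure {r : ChoiceVec n | IsWU r}),
        ρ ∈ convexHull ℝ (verticesWU n),
        LiftedFeasible matWU rhsWU ρ].TFAE := by
  exact ⟨⟨finite_vertices _ _, finite_vertices _ _, finite_vertices _ _⟩, fun ρ _ =>
    ⟨tfae_of_closure_eq _ _ (closure_isSS n) ρ, tfae_of_closure_eq _ _ (closure_isMU n) ρ,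
      tfae_of_closure_eq _ _ (closure_isWU n) ρ⟩⟩
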